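/- Let the channel power gains $h(1),h(2),\dots$ of successive blocks be i.i.d. with law $\nu$ (for instance $\nu(dh)=f_h\,dh$) carried by a compact set $\mathcal H\subset(0,\infty)$. Let $r$ be a concave, continuous, strictly increasing function on $[0,\infty)$ with $r(0)=0$, and let $r^{-1}$ denote its inverse, defined on its range. Let $R_0\ge 0$, $\alpha\ge 1$ and $\bar P\ge 0$. A policy chooses the power $P(k)\ge 0$ of block $k$ at random, with a law that depends measurably on the gains and powers of the earlier blocks and on the current gain $h(k)$; the gain $h(k)$ is independent of the gains and powers of the earlier blocks. Let $u(k)=1$ if $r(h(k)P(k))>R_0$ and $u(k)=0$ otherwise. Let $U_{\rm CSIT}$ be the optimal value (supremum) of the upper-bound problem $$\sup_{P(1),P(2),\dots}\ \lim_{K\to\infty}\frac1K\sum_{k=1}^K\mathbb E[r(h(k)P(k))]\quad\text{subject to}\quad \lim_{K\to\infty}\frac1K\sum_{k=1}^K\mathbb E[u(k)]\ge\frac1{2\alpha-1},\qquad \lim_{K\to\infty}\frac1K\sum_{k=1}^K\mathbb E[P(k)]\le\bar P,$$ over the policies for which these limits exist. For $\varepsilon>0$ with $R_0+\varepsilon$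 in the range of $r$, and for $x\ge 1$, let $R_\varepsilon(x)$ be the optimal value (supremum) of the age-independent stationary randomized policy problem $$\sup_{\mu,v^1,v^2}\ \int_{\mathcal H}\Big(\mu_h\, r\big(\tfrac{h v^1_h}{\mu_h}\big)+(1-\mu_h)\, r\big(\tfrac{h v^2_h}{1-\mu_h}\big)\Big)\,\nu(dh)$$ over measurable functions $\mu,v^1,v^2$ of $h$ such that, for all $h\in\mathcal H$, $0\le\mu_h\le 1$, $v^1_h\ge \mu_h\, r^{-1}(R_0+\varepsilon)/h$ and $0\le v^2_h\le(1-\mu_h)\,r^{-1}(R_0+\varepsilon)/h$, and such that $\int\mu_h\,\nu(dh)\ge 1/x$ and $\int (v^1_h+v^2_h)\,\nu(dh)\le\bar P$ (terms with weight $0$ count as $0$). Suppose that the latter problem with $x=2\alpha-1$ is feasible for some $\varepsilon>0$ with $R_0+\varepsilon$ in the range of $r$. Then $U_{\rm CSIT}$ is finite and equals the optimal value of the age-independent problem with $\alpha$ replaced by $2\alpha-1$, for arbitrarily small slack: $$U_{\rm CSIT}=R^{\rm AI\text{-}SRP}_{\rm CSIT}(2\alpha-1):=\lim_{\varepsilon\downarrow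 0}R_\varepsilon(2\alpha-1).$$ Moreover $U_{\rm CSIT}$ does not change if all policies are admitted and the limits of the throughput and of the success rate are replaced by lower limits and that of the power by the upper limit. -/

import Mathlib

open MeasureTheory ProbabilityTheory Filter Topology Set
open scoped ENNReal NNReal

namespace FadingAoI

/-- `r` is a rate function: on `[0,∞)` it is concave, strictly increasing and invertible, with
`r 0 = 0`. (A strictly increasing function on `[0,∞)` has an inverse defined on an interval of rates
exactly when it is continuous.) Values of `r` at negative arguments are irrelevant. -/
structure IsRateFunction (r : ℝ → ℝ) : Prop where
  zero : r 0 = 0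
  strictMono : StrictMonoOn r (Ici 0)
  concave : ConcaveOn ℝ (Ici 0) r
  continuous : ContinuousOn r (Ici 0)

/-- The inverse `r⁻¹` of the rate function, as a map from rates in the range `r '' [0,∞)` to
received signal-to-noise ratios in `[0,∞)`. -/
noncomputable def rateInv (r : ℝ → ℝ) : ℝ → ℝ := Function.invFunOn r (Ici 0)

/-- What has happened in the first `n` blocks: the pairs (gain, power) of these blocks. The ages of
information are functions of these data, so they need not be recorded separately. -/
abbrev History (n : ℕ) : Type := Fin n → ℝ × ℝ≥0

/-- A randomized, history-dependent power policy with perfect CSIT: in the block that follows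
`n` earlier blocks, the power is drawn from a probability law on `[0,∞)` that depends (measurably)
on the gains and powers of these blocks and on the gain of the current block. -/
structure Policy where
  kernel : (n : ℕ) → Kernel (History n × ℝ) ℝ≥0
  markov : ∀ n, IsMarkovKernel (kernel n)

attribute [instance] Policy.markov

/-- The law of the history of the first `n` blocks, when the gains are i.i.d. with law `ν` and the
powers are chosen by `π`. -/
noncomputable def histLaw (ν : Measure ℝ) (π : Policy) : (n : ℕ) → Measure (History n)
  | 0 => Measure.dirac Fin.elim0
  | n + 1 => (((histLaw ν π n).prod ν) ⊗ₘ (π.kernel n)).map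
      (fun z => (Fin.snoc z.1.1 (z.1.2, z.2) : History (n + 1)))

/-- The joint law of the past `z.1.1`, the gain `z.1.2` and the power `z.2` in the block that
follows `n` earlier blocks: the gain is independent of the past. -/
noncomputable def stepLaw (ν : Measure ℝ) (π : Policy) (n : ℕ) :
    Measure ((History n × ℝ) × ℝ≥0) :=
  ((histLaw ν π n).prod ν) ⊗ₘ (π.kernel n)

theorem measurable_snoc_step (n : ℕ) :
    Measurable (fun z : (History n × ℝ) × ℝ≥0 =>
      (Fin.snoc z.1.1 (z.1.2, z.2) : History (n + 1))) := by
  refine measurable_pi_lambda _ fun i => ?_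
  refine Fin.lastCases ?_ (fun j => ?_) i
  · simp only [Fin.snoc_last]; fun_prop
  · simp only [Fin.snoc_castSucc]; fun_prop

instance histLaw_isProbabilityMeasure (ν : Measure ℝ) [IsProbabilityMeasure ν] (π : Policy)
    (n : ℕ) : IsProbabilityMeasure (histLaw ν π n) := by
  induction n with
  | zero => unfold histLaw; infer_instance
  | succ n ih =>
    unfold histLaw
    exact Measure.isProbabilityMeasure_map (measurable_snoc_step n).aemeasurable

/-- `(1/K) ∑_{k=1}^K E[r(h(k) P(k))]`. -/
noncomputable def avgThroughput (r : ℝ → ℝ) (ν : Measure ℝ) (π : Policy) (K : ℕ) : ℝ≥0∞ :=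
  (∑ n ∈ Finset.range K, ∫⁻ z, ENNReal.ofReal (r (z.1.2 * z.2)) ∂(stepLaw ν π n)) / K

/-- `(1/K) ∑_{k=1}^K E[u(k)]`, where `u(k)` is the indicator of `r(h(k) P(k)) > R₀`. -/
noncomputable def avgSuccess (r : ℝ → ℝ) (R₀ : ℝ) (ν : Measure ℝ) (π : Policy) (K : ℕ) : ℝ≥0∞ :=
  (∑ n ∈ Finset.range K, stepLaw ν π n {z | R₀ < r (z.1.2 * z.2)}) / K

/-- `(1/K) ∑_{k=1}^K E[P(k)]`. -/
noncomputable def avgPower (ν : Measure ℝ) (π : Policy) (K : ℕ) : ℝ≥0∞ :=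
  (∑ n ∈ Finset.range K, ∫⁻ z, (z.2 : ℝ≥0∞) ∂(stepLaw ν π n)) / K

/-- The optimal value of the upper-bound problem: the supremum of the long-term average throughput
over all policies for which the three long-term averages exist as limits, the average number of
successful updates is at least `1 / (2α - 1)`, and the average power is at most `Pbar`. -/
noncomputable def upperBoundValue (r : ℝ → ℝ) (R₀ : ℝ) (ν : Measure ℝ) (α : ℝ) (Pbar : ℝ≥0) :
    ℝ≥0∞ :=
  sSup {ρ : ℝ≥0∞ | ∃ π : Policy,
    Tendsto (avgThroughput r ν π) atTop (𝓝 ρ) ∧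
    (∃ s : ℝ≥0∞, Tendsto (avgSuccess r R₀ ν π) atTop (𝓝 s) ∧
      ENNReal.ofReal (1 / (2 * α - 1)) ≤ s) ∧
    (∃ p : ℝ≥0∞, Tendsto (avgPower ν π) atTop (𝓝 p) ∧ p ≤ (Pbar : ℝ≥0∞))}

/-- The same problem over all policies, whether or not the limits exist: the averages of the rewards
are read as lower limits and the average of the power as an upper limit. -/
noncomputable def upperBoundValueLiminf (r : ℝ → ℝ) (R₀ : ℝ) (ν : Measure ℝ) (α : ℝ)
    (Pbar : ℝ≥0) : ℝ≥0∞ :=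
  sSup {ρ : ℝ≥0∞ | ∃ π : Policy,
    ρ = liminf (avgThroughput r ν π) atTop ∧
    ENNReal.ofReal (1 / (2 * α - 1)) ≤ liminf (avgSuccess r R₀ ν π) atTop ∧
    limsup (avgPower ν π) atTop ≤ (Pbar : ℝ≥0∞)}

/-- Feasibility of `(μ, v₁, v₂)` (functions of the gain) for the age-independent problem with
average-age bound `x` and slack `ε`. -/
structure AISRPFeasible (r : ℝ → ℝ) (R₀ : ℝ) (H : Set ℝ) (ν : Measure ℝ) (Pbar : ℝ≥0) (ε x : ℝ)
    (μ v₁ v₂ : ℝ → ℝ) : Prop where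
  measurable_μ : Measurable μ
  measurable_v₁ : Measurable v₁
  measurable_v₂ : Measurable v₂
  μ_nonneg : ∀ h ∈ H, 0 ≤ μ h
  μ_le_one : ∀ h ∈ H, μ h ≤ 1
  v₁_nonneg : ∀ h ∈ H, 0 ≤ v₁ h
  v₂_nonneg : ∀ h ∈ H, 0 ≤ v₂ h
  age : 1 / x ≤ ∫ h, μ h ∂ν
  power : ∫⁻ h, ENNReal.ofReal (v₁ h + v₂ h) ∂ν ≤ (Pbar : ℝ≥0∞)
  le_v₁ : ∀ h ∈ H, μ h * (rateInv r (R₀ + ε) / h) ≤ v₁ h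
  v₂_le : ∀ h ∈ H, v₂ h ≤ (1 - μ h) * (rateInv r (R₀ + ε) / h)

/-- The throughput of `(μ, v₁, v₂)`; a term whose weight `μ h` or `1 - μ h` is `0` contributes `0`. -/
noncomputable def aisrpThroughput (r : ℝ → ℝ) (ν : Measure ℝ) (μ v₁ v₂ : ℝ → ℝ) : ℝ≥0∞ :=
  ∫⁻ h, ENNReal.ofReal
    (μ h * r (h * v₁ h / μ h) + (1 - μ h) * r (h * v₂ h / (1 - μ h))) ∂ν

/-- The optimal value `R^{AI-SRP}_CSIT(x)` of the age-independent problem with slack `ε`. -/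
noncomputable def aisrpValue (r : ℝ → ℝ) (R₀ : ℝ) (H : Set ℝ) (ν : Measure ℝ) (Pbar : ℝ≥0)
    (ε x : ℝ) : ℝ≥0∞ :=
  sSup {ρ : ℝ≥0∞ | ∃ μ v₁ v₂ : ℝ → ℝ, AISRPFeasible r R₀ H ν Pbar ε x μ v₁ v₂ ∧
    ρ = aisrpThroughput r ν μ v₁ v₂}

end FadingAoI

/-!
The throughput, the success rate and the power of a policy are linear in the joint law `Q` of the
gain and the power of a block, and the only restriction on `Q` is that its first marginal be `ν`.

*The age-independent value is attained by policies.* Every law `Q` with first marginal `ν` is that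
of a stationary policy, which draws the power from the conditional law given the gain
(`exists_policy_gainPowerLaw_eq`). For a feasible `(μ, v₁, v₂)` with slack `ε` one takes the law
with power `v₁ h / μ h` with probability `μ h` and `v₂ h / (1 - μ h)` otherwise; hence `R_ε ≤
U_CSIT` for all small `ε` (`AISRPFeasible.throughput_le_upperBoundValue`).

*No policy does better.* Conversely, if `Q` meets the success requirement with slack `ε` and the
power constraint, conditioning on the gain and on success and averaging the power over each of the
two outcomes gives a feasible `(μ, v₁, v₂)` whose throughput is at least as large, by Jensen's
inequality (`le_aisrpValue`). This is applied to the average `Q_K` of the laws of the first `K`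
blocks under an arbitrary policy. For large `K` it violates the constraints only slightly, and for
small `ε` the slack costs little success probability (`exists_slack_of_lt_success`). The success
probability is repaired exactly by raising some failing powers, at a small cost in power
(`exists_law_success_ge`). The power constraint is then repaired by mixing in, with a small weight,
a law that leaves power unused: the given feasible point with slack `ε₀` provides one for every `ε
≤ ε₀ / 2`, as the power needed for success is strictly increasing in the slack
(`exists_law_with_spare_power`). Thus the lower limit of the throughput of any policy is at most
`liminf R_ε` (`liminf_avgThroughput_le`). Both forms of the upper-bound problem therefore lie
between `limsup R_ε` and `liminf R_ε`. They are finite because a concave rate grows at most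
linearly (`upperBoundValue_lt_top`).
-/

namespace FadingAoI

/-! ### Rate functions and their inverses -/

section RateFunction

variable {r : ℝ → ℝ}

theorem rateInv_nonneg {s : ℝ} (hs : s ∈ r '' Ici 0) : 0 ≤ rateInv r s :=
  Function.invFunOn_mem hs

theorem apply_rateInv {s : ℝ} (hs : s ∈ r '' Ici 0) : r (rateInv r s) = s :=
  Function.invFunOn_eq hs

theorem IsRateFunction.rateInv_le_iff (hr : IsRateFunction r) {s y : ℝ} (hs : s ∈ r '' Ici 0)
    (hy : 0 ≤ y) : rateInv r s ≤ y ↔ s ≤ r y := by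
  rw [← hr.strictMono.le_iff_le (rateInv_nonneg hs) hy, apply_rateInv hs]

theorem IsRateFunction.rateInv_lt (hr : IsRateFunction r) {s s' : ℝ} (hs : s ∈ r '' Ici 0)
    (hs' : s' ∈ r '' Ici 0) (h : s < s') : rateInv r s < rateInv r s' := by
  rwa [← hr.strictMono.lt_iff_lt (rateInv_nonneg hs) (rateInv_nonneg hs'), apply_rateInv hs,
    apply_rateInv hs']

theorem IsRateFunction.mem_range_of_le (hr : IsRateFunction r) {s s' : ℝ} (hs : 0 ≤ s)
    (hss' : s ≤ s') (hs' : s' ∈ r '' Ici 0) : s ∈ r '' Ici 0 := by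
  obtain ⟨y, hy, rfl⟩ := hs'
  have h := intermediate_value_Icc (f := r) (mem_Ici.1 hy) (hr.continuous.mono Icc_subset_Ici_self)
  obtain ⟨z, hz, rfl⟩ := h ⟨hr.zero.trans_le hs, hss'⟩
  exact ⟨z, hz.1, rfl⟩

theorem IsRateFunction.nonneg (hr : IsRateFunction r) {y : ℝ} (hy : 0 ≤ y) : 0 ≤ r y := by
  rw [← hr.zero]
  exact hr.strictMono.monotoneOn self_mem_Ici hy hy

/-- A rate function grows at most linearly, by concavity and `r 0 = 0`. -/
theorem IsRateFunction.le_mul (hr : IsRateFunction r) {y : ℝ} (hy : 0 ≤ y) :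
    r y ≤ r 1 * (1 + y) := by
  have h1 : 0 ≤ r 1 := hr.nonneg zero_le_one
  rcases le_total y 1 with hy1 | hy1
  · have := hr.strictMono.monotoneOn hy (mem_Ici.2 zero_le_one) hy1
    nlinarith
  · have hy0 : 0 < y := by linarith
    have h := hr.concave.2 (mem_Ici.2 hy) (mem_Ici.2 le_rfl) (inv_nonneg.2 hy)
      (sub_nonneg.2 (inv_le_one_of_one_le₀ hy1)) (by ring)
    simp only [smul_eq_mul, hr.zero, mul_zero, add_zero, inv_mul_cancel₀ hy0.ne'] at h
    rw [inv_mul_le_iff₀ hy0] at h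
    linarith

/-- The rate at received signal-to-noise ratio `y` as an extended nonnegative number. Negative
arguments are sent to `0`, which makes the function monotone and hence measurable on all of `ℝ`. -/
noncomputable def reward (r : ℝ → ℝ) (y : ℝ) : ℝ≥0∞ := ENNReal.ofReal (r (max y 0))

theorem reward_of_nonneg {y : ℝ} (hy : 0 ≤ y) : reward r y = ENNReal.ofReal (r y) := by
  rw [reward, max_eq_left hy]

theorem IsRateFunction.monotone_reward (hr : IsRateFunction r) : Monotone (reward r) :=
  fun _ _ h => ENNReal.ofReal_le_ofReal <| hr.strictMono.monotoneOn (mem_Ici.2 (le_max_right _ _))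
    (mem_Ici.2 (le_max_right _ _)) (max_le_max_right 0 h)

@[fun_prop]
theorem IsRateFunction.measurable_reward (hr : IsRateFunction r) : Measurable (reward r) :=
  hr.monotone_reward.measurable

end RateFunction

/-! ### Joint laws of gain and power -/

section Laws

variable {ν : Measure ℝ}

theorem isProbabilityMeasure_of_fst [IsProbabilityMeasure ν] {Q : Measure (ℝ × ℝ≥0)}
    (hQ : Q.fst = ν) : IsProbabilityMeasure Q :=
  ⟨by rw [← Measure.fst_univ, hQ, measure_univ]⟩

theorem ae_fst_of_fst_eq {Q : Measure (ℝ × ℝ≥0)} (hQ : Q.fst = ν) {p : ℝ → Prop}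
    (hp : ∀ᵐ h ∂ν, p h) : ∀ᵐ z ∂Q, p z.1 := by
  rw [← hQ, Measure.fst] at hp
  exact ae_of_ae_map measurable_fst.aemeasurable hp

theorem measurableSet_success (t : ℝ) : MeasurableSet {z : ℝ × ℝ≥0 | t ≤ z.1 * z.2} :=
  measurableSet_le measurable_const (by fun_prop)

/-- The law of the gain and the power of the block that follows `n` earlier blocks. -/
noncomputable def gainPowerLaw (ν : Measure ℝ) (π : Policy) (n : ℕ) : Measure (ℝ × ℝ≥0) :=
  (stepLaw ν π n).map fun z => (z.1.2, z.2)

/-- The average of the joint laws of gain and power over the first `K` blocks. -/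
noncomputable def avgLaw (ν : Measure ℝ) (π : Policy) (K : ℕ) : Measure (ℝ × ℝ≥0) :=
  (K : ℝ≥0∞)⁻¹ • ∑ n ∈ Finset.range K, gainPowerLaw ν π n

theorem lintegral_gainPowerLaw (π : Policy) (n : ℕ) {f : ℝ × ℝ≥0 → ℝ≥0∞} (hf : Measurable f) :
    ∫⁻ z, f z ∂gainPowerLaw ν π n = ∫⁻ z, f (z.1.2, z.2) ∂stepLaw ν π n :=
  lintegral_map hf (by fun_prop)

theorem gainPowerLaw_fst [IsProbabilityMeasure ν] (π : Policy) (n : ℕ) :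
    (gainPowerLaw ν π n).fst = ν := by
  rw [gainPowerLaw, Measure.fst, Measure.map_map measurable_fst (by fun_prop)]
  have : (Prod.fst ∘ fun z : (History n × ℝ) × ℝ≥0 => (z.1.2, z.2)) = Prod.snd ∘ Prod.fst := rfl
  rw [this, ← Measure.map_map measurable_snd measurable_fst]
  have h : (stepLaw ν π n).map Prod.fst = (histLaw ν π n).prod ν := Measure.fst_compProd _ _
  rw [h]
  exact Measure.snd_prod

theorem lintegral_avgLaw (π : Policy) (K : ℕ) {f : ℝ × ℝ≥0 → ℝ≥0∞} (hf : Measurable f) :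
    ∫⁻ z, f z ∂avgLaw ν π K =
      (∑ n ∈ Finset.range K, ∫⁻ z, f (z.1.2, z.2) ∂stepLaw ν π n) / K := by
  simp only [avgLaw, lintegral_smul_measure, lintegral_finsetSum_measure,
    lintegral_gainPowerLaw π _ hf, smul_eq_mul]
  rw [mul_comm, div_eq_mul_inv]

theorem avgLaw_fst [IsProbabilityMeasure ν] (π : Policy) {K : ℕ} (hK : K ≠ 0) :
    (avgLaw ν π K).fst = ν := by
  have hK' : (K : ℝ≥0∞) ≠ 0 := by exact_mod_cast hK
  ext s hs
  have (n : ℕ) : gainPowerLaw ν π n (Prod.fst ⁻¹' s) = ν s := by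
    rw [← Measure.fst_apply hs, gainPowerLaw_fst]
  simp [Measure.fst_apply hs, avgLaw, this, ← mul_assoc, ENNReal.inv_mul_cancel hK']

theorem ae_pos_stepLaw [IsProbabilityMeasure ν] (hpos : ∀ᵐ h ∂ν, 0 < h) (π : Policy) (n : ℕ) :
    ∀ᵐ z ∂stepLaw ν π n, (0 : ℝ) ≤ z.1.2 * z.2 := by
  have h := ae_of_ae_map (f := fun z : (History n × ℝ) × ℝ≥0 => (z.1.2, z.2)) (by fun_prop)
    (ae_fst_of_fst_eq (gainPowerLaw_fst (ν := ν) π n) hpos)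
  filter_upwards [h] with z hz
  exact mul_nonneg hz.le z.2.2

theorem avgThroughput_eq [IsProbabilityMeasure ν] {r : ℝ → ℝ} (hr : IsRateFunction r)
    (hpos : ∀ᵐ h ∂ν, 0 < h) (π : Policy) (K : ℕ) :
    avgThroughput r ν π K = ∫⁻ z, reward r (z.1 * z.2) ∂avgLaw ν π K := by
  have := hr.measurable_reward
  rw [lintegral_avgLaw (f := fun z => reward r (z.1 * z.2)) π K (by fun_prop), avgThroughput]
  congr 1
  refine Finset.sum_congr rfl fun n _ => lintegral_congr_ae ?_
  filter_upwards [ae_pos_stepLaw hpos π n] with z hz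
  rw [reward_of_nonneg hz]

theorem avgPower_eq (π : Policy) (K : ℕ) :
    avgPower ν π K = ∫⁻ z, (z.2 : ℝ≥0∞) ∂avgLaw ν π K := by
  rw [lintegral_avgLaw (f := fun z => (z.2 : ℝ≥0∞)) π K (by fun_prop), avgPower]

/-- The set of (gain, power) pairs that deliver an update, in a form that is measurable whatever the
values of `r` at negative arguments. -/
def successSet (r : ℝ → ℝ) (R₀ : ℝ) : Set (ℝ × ℝ≥0) := {z | R₀ < r (max (z.1 * z.2) 0)}

theorem IsRateFunction.measurableSet_successSet {r : ℝ → ℝ} (hr : IsRateFunction r) (R₀ : ℝ) :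
    MeasurableSet (successSet r R₀) := by
  have : Monotone fun y : ℝ => r (max y 0) := fun _ _ h =>
    hr.strictMono.monotoneOn (mem_Ici.2 (le_max_right _ _))
      (mem_Ici.2 (le_max_right _ _)) (max_le_max_right 0 h)
  have := this.measurable
  exact measurableSet_lt (f := fun _ : ℝ × ℝ≥0 => R₀)
    (g := fun z : ℝ × ℝ≥0 => r (max (z.1 * z.2) 0)) measurable_const
    (this.comp (g := fun y : ℝ => r (max y 0)) (f := fun z : ℝ × ℝ≥0 => (z.1 * z.2 : ℝ))
      (by fun_prop))

theorem avgSuccess_eq [IsProbabilityMeasure ν] {r : ℝ → ℝ} (hr : IsRateFunction r)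
    (hpos : ∀ᵐ h ∂ν, 0 < h) (R₀ : ℝ) (π : Policy) (K : ℕ) :
    avgSuccess r R₀ ν π K = avgLaw ν π K (successSet r R₀) := by
  have hS := hr.measurableSet_successSet R₀
  rw [← lintegral_indicator_one hS, lintegral_avgLaw π K (measurable_one.indicator hS),
    avgSuccess]
  congr 1
  refine Finset.sum_congr rfl fun n _ => ?_
  have : (fun z : (History n × ℝ) × ℝ≥0 =>
      (successSet r R₀).indicator (1 : ℝ × ℝ≥0 → ℝ≥0∞) (z.1.2, z.2)) =
      ((fun z : (History n × ℝ) × ℝ≥0 => (z.1.2, z.2)) ⁻¹' successSet r R₀).indicator 1 := rfl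
  rw [this, lintegral_indicator_one (hS.preimage (by fun_prop))]
  refine measure_congr ?_
  filter_upwards [ae_pos_stepLaw hpos π n] with z hz
  change (R₀ < _) = (R₀ < _)
  rw [max_eq_left hz]

/-! ### Stationary randomized policies -/

theorem exists_kernel_compProd_eq [IsProbabilityMeasure ν] {Q : Measure (ℝ × ℝ≥0)}
    (hQ : Q.fst = ν) : ∃ κ : Kernel ℝ ℝ≥0, IsMarkovKernel κ ∧ ν ⊗ₘ κ = Q := by
  have := isProbabilityMeasure_of_fst hQ
  exact ⟨Q.condKernel, inferInstance, by rw [← hQ, Q.disintegrate Q.condKernel]⟩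

/-- Every joint law with the right gain marginal is realized in every block by some policy: draw the
power from the conditional law given the current gain. -/
theorem exists_policy_gainPowerLaw_eq [IsProbabilityMeasure ν] {Q : Measure (ℝ × ℝ≥0)}
    (hQ : Q.fst = ν) : ∃ π : Policy, ∀ n, gainPowerLaw ν π n = Q := by
  obtain ⟨κ, hκ, rfl⟩ := exists_kernel_compProd_eq hQ
  let π : Policy := ⟨fun n => κ.comap Prod.snd measurable_snd, fun n => inferInstance⟩
  refine ⟨π, fun n => ?_⟩
  ext s hs
  rw [gainPowerLaw, Measure.map_apply (by fun_prop) hs, stepLaw,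
    Measure.compProd_apply (hs.preimage (by fun_prop)), Measure.compProd_apply hs]
  have hsnd : ((histLaw ν π n).prod ν).map Prod.snd = ν := Measure.snd_prod
  conv_rhs => rw [← hsnd]
  rw [lintegral_map (Kernel.measurable_kernel_prodMk_left hs) measurable_snd]
  rfl

theorem le_upperBoundValue [IsProbabilityMeasure ν] {r : ℝ → ℝ} (hr : IsRateFunction r)
    (hpos : ∀ᵐ h ∂ν, 0 < h) {R₀ α : ℝ} {Pbar : ℝ≥0} {Q : Measure (ℝ × ℝ≥0)} (hQ : Q.fst = ν)
    (hs : ENNReal.ofReal (1 / (2 * α - 1)) ≤ Q (successSet r R₀))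
    (hp : ∫⁻ z, (z.2 : ℝ≥0∞) ∂Q ≤ Pbar) :
    ∫⁻ z, reward r (z.1 * z.2) ∂Q ≤ upperBoundValue r R₀ ν α Pbar := by
  obtain ⟨π, hπ⟩ := exists_policy_gainPowerLaw_eq hQ
  have havg {K : ℕ} (hK : K ≠ 0) : avgLaw ν π K = Q := by
    have hK' : (K : ℝ≥0∞) ≠ 0 := by exact_mod_cast hK
    simp only [avgLaw, hπ, Finset.sum_const, Finset.card_range, ← Nat.cast_smul_eq_nsmul ℝ≥0∞,
      smul_smul, ENNReal.inv_mul_cancel hK' (ENNReal.natCast_ne_top K), one_smul]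
  refine le_sSup ⟨π, ?_, ⟨_, ?_, hs⟩, ⟨_, ?_, hp⟩⟩ <;>
    refine tendsto_const_nhds.congr' ?_ <;>
    filter_upwards [eventually_ne_atTop 0] with K hK
  · rw [avgThroughput_eq hr hpos, havg hK]
  · rw [avgSuccess_eq hr hpos, havg hK]
  · rw [avgPower_eq, havg hK]

end Laws

section TwoPoint

variable {ν : Measure ℝ} {m : ℝ → ℝ≥0∞} {p₁ p₂ : ℝ → ℝ≥0}

/-- The joint law of gain and power when, given the gain `h`, the power is `p₁ h` with probability
`m h` and `p₂ h` otherwise. -/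
noncomputable def twoPointLaw (ν : Measure ℝ) (m : ℝ → ℝ≥0∞) (p₁ p₂ : ℝ → ℝ≥0) :
    Measure (ℝ × ℝ≥0) :=
  (ν.withDensity m).map (fun h => (h, p₁ h)) +
    (ν.withDensity fun h => 1 - m h).map (fun h => (h, p₂ h))

theorem lintegral_twoPointLaw (hm : Measurable m) (hp₁ : Measurable p₁) (hp₂ : Measurable p₂)
    {f : ℝ × ℝ≥0 → ℝ≥0∞} (hf : Measurable f) :
    ∫⁻ z, f z ∂twoPointLaw ν m p₁ p₂ =
      ∫⁻ h, m h * f (h, p₁ h) + (1 - m h) * f (h, p₂ h) ∂ν := by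
  rw [twoPointLaw, lintegral_add_measure, lintegral_map hf (by fun_prop),
    lintegral_map hf (by fun_prop), lintegral_withDensity_eq_lintegral_mul _ hm (by fun_prop),
    lintegral_withDensity_eq_lintegral_mul _ (by fun_prop) (by fun_prop),
    ← lintegral_add_left (by fun_prop)]
  rfl

theorem twoPointLaw_apply (hm : Measurable m) (hp₁ : Measurable p₁) (hp₂ : Measurable p₂)
    {s : Set (ℝ × ℝ≥0)} (hs : MeasurableSet s) :
    twoPointLaw ν m p₁ p₂ s =
      ∫⁻ h, m h * s.indicator 1 (h, p₁ h) + (1 - m h) * s.indicator 1 (h, p₂ h) ∂ν := by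
  rw [← lintegral_indicator_one hs,
    lintegral_twoPointLaw hm hp₁ hp₂ (measurable_one.indicator hs)]

theorem twoPointLaw_fst (hm : Measurable m) (hp₁ : Measurable p₁) (hp₂ : Measurable p₂)
    (hm1 : ∀ᵐ h ∂ν, m h ≤ 1) : (twoPointLaw ν m p₁ p₂).fst = ν := by
  ext s hs
  rw [Measure.fst_apply hs, twoPointLaw_apply hm hp₁ hp₂ (measurable_fst hs),
    ← lintegral_indicator_one hs]
  refine lintegral_congr_ae ?_
  filter_upwards [hm1] with h hh
  by_cases hhs : h ∈ s <;> simp [indicator, hhs, add_tsub_cancel_of_le hh]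

end TwoPoint

section AgeIndependent

variable {r : ℝ → ℝ} {R₀ ε x : ℝ} {H : Set ℝ} {ν : Measure ℝ} {Pbar : ℝ≥0} {μ v₁ v₂ : ℝ → ℝ}

theorem AISRPFeasible.ofReal_age_le [IsFiniteMeasure ν]
    (hf : AISRPFeasible r R₀ H ν Pbar ε x μ v₁ v₂) (hH : ∀ᵐ h ∂ν, h ∈ H) :
    ENNReal.ofReal (1 / x) ≤ ∫⁻ h, ENNReal.ofReal (μ h) ∂ν := by
  rw [← ofReal_integral_eq_lintegral_ofReal]
  · exact ENNReal.ofReal_le_ofReal hf.age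
  · refine Integrable.of_bound hf.measurable_μ.aestronglyMeasurable 1 ?_
    filter_upwards [hH] with h hh
    rw [Real.norm_of_nonneg (hf.μ_nonneg h hh)]
    exact hf.μ_le_one h hh
  · filter_upwards [hH] with h hh using hf.μ_nonneg h hh

/-- The age-independent policy `(μ, v₁, v₂)` is an admissible stationary policy of the upper-bound
problem: use power `v₁ h / μ h` with probability `μ h` and `v₂ h / (1 - μ h)` otherwise. -/
theorem AISRPFeasible.throughput_le_upperBoundValue [IsProbabilityMeasure ν]
    (hr : IsRateFunction r) (hHpos : H ⊆ Ioi 0) (hH : ∀ᵐ h ∂ν, h ∈ H) (hε : 0 < ε)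
    (hrange : R₀ + ε ∈ r '' Ici 0) {α : ℝ}
    (hf : AISRPFeasible r R₀ H ν Pbar ε (2 * α - 1) μ v₁ v₂) :
    aisrpThroughput r ν μ v₁ v₂ ≤ upperBoundValue r R₀ ν α Pbar := by
  have hpos : ∀ᵐ h ∂ν, 0 < h := hH.mono fun h hh => hHpos hh
  have hμ := hf.measurable_μ
  have hv₁ := hf.measurable_v₁
  have hv₂ := hf.measurable_v₂
  have hrm := hr.measurable_reward
  have hS := hr.measurableSet_successSet R₀
  set m : ℝ → ℝ≥0∞ := fun h => ENNReal.ofReal (μ h) with hm_def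
  set p₁ : ℝ → ℝ≥0 := fun h => (v₁ h / μ h).toNNReal
  set p₂ : ℝ → ℝ≥0 := fun h => (v₂ h / (1 - μ h)).toNNReal
  have hm : Measurable m := by fun_prop
  have hp₁ : Measurable p₁ := by fun_prop
  have hp₂ : Measurable p₂ := by fun_prop
  have hsub {h : ℝ} (hh : h ∈ H) : 1 - m h = ENNReal.ofReal (1 - μ h) := by
    rw [hm_def, ENNReal.ofReal_sub _ (hf.μ_nonneg h hh), ENNReal.ofReal_one]
  have hc₁ {h : ℝ} (hh : h ∈ H) : (p₁ h : ℝ) = v₁ h / μ h :=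
    Real.coe_toNNReal _ (div_nonneg (hf.v₁_nonneg h hh) (hf.μ_nonneg h hh))
  have hc₂ {h : ℝ} (hh : h ∈ H) : (p₂ h : ℝ) = v₂ h / (1 - μ h) :=
    Real.coe_toNNReal _ (div_nonneg (hf.v₂_nonneg h hh) (sub_nonneg.2 (hf.μ_le_one h hh)))
  have hQ : (twoPointLaw ν m p₁ p₂).fst = ν := twoPointLaw_fst hm hp₁ hp₂ <| by
    filter_upwards [hH] with h hh using ENNReal.ofReal_le_one.2 (hf.μ_le_one h hh)
  refine le_trans (le_of_eq ?_) (le_upperBoundValue hr hpos (Q := twoPointLaw ν m p₁ p₂) hQ ?_ ?_)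
  · rw [lintegral_twoPointLaw (f := fun z => reward r (z.1 * z.2)) hm hp₁ hp₂ (by fun_prop),
      aisrpThroughput]
    refine lintegral_congr_ae ?_
    filter_upwards [hH] with h hh
    have h0 : 0 < h := hHpos hh
    have h1 : 0 ≤ h * p₁ h := by positivity
    have h2 : 0 ≤ h * p₂ h := by positivity
    rw [hsub hh, reward_of_nonneg h1, reward_of_nonneg h2,
      ← ENNReal.ofReal_mul (hf.μ_nonneg h hh),
      ← ENNReal.ofReal_mul (sub_nonneg.2 (hf.μ_le_one h hh)), ← ENNReal.ofReal_add
        (mul_nonneg (hf.μ_nonneg h hh) (hr.nonneg h1))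
        (mul_nonneg (sub_nonneg.2 (hf.μ_le_one h hh)) (hr.nonneg h2)), hc₁ hh, hc₂ hh,
      mul_div_assoc, mul_div_assoc]
  · rw [twoPointLaw_apply hm hp₁ hp₂ hS]
    refine (hf.ofReal_age_le hH).trans (lintegral_mono_ae ?_)
    filter_upwards [hH] with h hh
    refine le_trans ?_ le_self_add
    have h0 : 0 < h := hHpos hh
    rcases (hf.μ_nonneg h hh).eq_or_lt with hμ0 | hμ0
    · simp [← hμ0]
    · have hmem : (h, p₁ h) ∈ successSet r R₀ := by
        change R₀ < r (max (h * p₁ h) 0)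
        have h1 : 0 ≤ h * p₁ h := by positivity
        rw [max_eq_left h1]
        refine (lt_add_of_pos_right R₀ hε).trans_le ((hr.rateInv_le_iff hrange h1).1 ?_)
        rw [hc₁ hh, ← div_le_iff₀' h0, le_div_iff₀' hμ0]
        exact hf.le_v₁ h hh
      simp [hmem, hm_def]
  · rw [lintegral_twoPointLaw (f := fun z => (z.2 : ℝ≥0∞)) hm hp₁ hp₂ (by fun_prop)]
    refine (lintegral_mono_ae ?_).trans hf.power
    filter_upwards [hH] with h hh
    rw [hsub hh, ENNReal.ofReal_add (hf.v₁_nonneg h hh) (hf.v₂_nonneg h hh)]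
    have aux {a v : ℝ} (ha : 0 ≤ a) (hv : 0 ≤ v) :
        ENNReal.ofReal a * ((v / a).toNNReal : ℝ≥0∞) ≤ ENNReal.ofReal v := by
      change _ * ENNReal.ofReal _ ≤ _
      rw [← ENNReal.ofReal_mul ha]
      refine ENNReal.ofReal_le_ofReal ?_
      rcases ha.eq_or_lt with rfl | ha
      · simpa using hv
      · rw [mul_div_cancel₀ _ ha.ne']
    exact add_le_add (aux (hf.μ_nonneg h hh) (hf.v₁_nonneg h hh))
      (aux (sub_nonneg.2 (hf.μ_le_one h hh)) (hf.v₂_nonneg h hh))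

end AgeIndependent

/-! ### Averaging the power over each outcome -/

section Jensen

variable {r : ℝ → ℝ}

/-- Jensen's inequality on an event: replacing the power by its conditional mean does not decrease
the expected rate. -/
theorem IsRateFunction.setLIntegral_reward_le (hr : IsRateFunction r) (κ : Measure ℝ≥0)
    [IsFiniteMeasure κ] (A : Set ℝ≥0) {h : ℝ} (hh : 0 < h)
    (hfin : ∫⁻ p in A, (p : ℝ≥0∞) ∂κ ≠ ⊤) :
    ∫⁻ p in A, reward r (h * p) ∂κ ≤
      ENNReal.ofReal (κ.real A * r (h * (∫⁻ p in A, (p : ℝ≥0∞) ∂κ).toReal / κ.real A)) := by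
  rcases eq_or_ne (κ A) 0 with hA | hA
  · simp [Measure.restrict_eq_zero.2 hA]
  have hA' : 0 < κ.real A := ENNReal.toReal_pos hA (measure_ne_top _ _)
  have hnn (p : ℝ≥0) : 0 ≤ h * p := by positivity
  have hint : Integrable (fun p : ℝ≥0 => (p : ℝ)) (κ.restrict A) := by
    refine ⟨by fun_prop, ?_⟩
    rw [hasFiniteIntegral_iff_enorm]
    simpa using hfin.lt_top
  have hfi : IntegrableOn (fun p : ℝ≥0 => h * (p : ℝ)) A κ := hint.const_mul h
  have hrm := hr.measurable_reward
  have hreq (p : ℝ≥0) : (reward r (h * p)).toReal = r (h * p) := by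
    rw [reward_of_nonneg (hnn p), ENNReal.toReal_ofReal (hr.nonneg (hnn p))]
  have hgi : IntegrableOn (r ∘ fun p : ℝ≥0 => h * (p : ℝ)) A κ := by
    refine Integrable.mono' (((integrable_const (1 : ℝ)).add hfi).const_mul (r 1)) ?_
      (ae_of_all _ fun p => ?_)
    · have : (r ∘ fun p : ℝ≥0 => h * (p : ℝ)) = fun p : ℝ≥0 => (reward r (h * p)).toReal :=
        funext fun p => (hreq p).symm
      rw [this]
      exact Measurable.aestronglyMeasurable (by fun_prop)
    · simp only [Function.comp_apply, Pi.add_apply]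
      rw [Real.norm_of_nonneg (hr.nonneg (hnn p))]
      exact hr.le_mul (hnn p)
  have hJ := hr.concave.le_map_set_average hr.continuous isClosed_Ici hA (measure_ne_top _ _)
    (ae_of_all _ hnn) hfi hgi
  have hmean : ∫ p in A, h * (p : ℝ) ∂κ = h * (∫⁻ p in A, (p : ℝ≥0∞) ∂κ).toReal := by
    rw [integral_const_mul, integral_eq_lintegral_of_nonneg_ae (ae_of_all _ fun p => p.2)
      (by fun_prop)]
    simp
  rw [setAverage_eq, setAverage_eq, smul_eq_mul, smul_eq_mul, inv_mul_le_iff₀ hA', hmean,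
    ← div_eq_inv_mul] at hJ
  refine le_trans (le_of_eq ?_) (ENNReal.ofReal_le_ofReal hJ)
  refine Eq.trans ?_ (ofReal_integral_eq_lintegral_ofReal hgi
    (ae_of_all _ fun p => hr.nonneg (hnn p))).symm
  exact lintegral_congr fun p => reward_of_nonneg (hnn p)

/-- A joint law of gain and power that meets the success requirement with slack `ε` and the power
constraint does not beat the age-independent problem: condition on the gain and on success, and
average the power over each of the two outcomes. -/
theorem le_aisrpValue (hr : IsRateFunction r) {R₀ ε x : ℝ} {H : Set ℝ} (hHpos : H ⊆ Ioi 0)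
    {ν : Measure ℝ} [IsProbabilityMeasure ν] (hH : ∀ᵐ h ∂ν, h ∈ H) {Pbar : ℝ≥0}
    (hrange : R₀ + ε ∈ r '' Ici 0) {Q : Measure (ℝ × ℝ≥0)} (hQ : Q.fst = ν)
    (hs : ENNReal.ofReal (1 / x) ≤ Q {z | rateInv r (R₀ + ε) ≤ z.1 * z.2})
    (hp : ∫⁻ z, (z.2 : ℝ≥0∞) ∂Q ≤ Pbar) :
    ∫⁻ z, reward r (z.1 * z.2) ∂Q ≤ aisrpValue r R₀ H ν Pbar ε x := by
  obtain ⟨κ, hκ, rfl⟩ := exists_kernel_compProd_eq hQ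
  have hrm := hr.measurable_reward
  have ht0 := rateInv_nonneg hrange
  set t := rateInv r (R₀ + ε)
  have hS : MeasurableSet {z : ℝ × ℝ≥0 | t ≤ z.1 * z.2} := measurableSet_success t
  set A : ℝ → Set ℝ≥0 := fun h => {p | t ≤ h * p}
  have hA (h : ℝ) : MeasurableSet (A h) := measurable_prodMk_left (x := h) hS
  set μ : ℝ → ℝ := fun h => (κ h).real (A h)
  set w₁ : ℝ → ℝ≥0∞ := fun h => ∫⁻ p in A h, (p : ℝ≥0∞) ∂κ h
  set w₂ : ℝ → ℝ≥0∞ := fun h => ∫⁻ p in (A h)ᶜ, (p : ℝ≥0∞) ∂κ h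
  have hκm : Measurable fun h => κ h (A h) := Kernel.measurable_kernel_prodMk_left hS
  have hμm : Measurable μ := hκm.ennreal_toReal
  have hw (B : Set (ℝ × ℝ≥0)) (hB : MeasurableSet B) :
      Measurable fun h => ∫⁻ p in Prod.mk h ⁻¹' B, (p : ℝ≥0∞) ∂κ h := by
    have : (fun h => ∫⁻ p in Prod.mk h ⁻¹' B, (p : ℝ≥0∞) ∂κ h) =
        fun h => ∫⁻ p, B.indicator (fun z => (z.2 : ℝ≥0∞)) (h, p) ∂κ h := by
      ext h
      rw [← lintegral_indicator (measurable_prodMk_left hB)]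
      rfl
    rw [this]
    refine Measurable.lintegral_kernel_prod_right (f := fun h p =>
      B.indicator (fun z => (z.2 : ℝ≥0∞)) (h, p)) ?_
    exact Measurable.indicator (by fun_prop) hB
  have hw₁m : Measurable w₁ := hw _ hS
  have hw₂m : Measurable w₂ := hw _ hS.compl
  have hsum (h : ℝ) : w₁ h + w₂ h = ∫⁻ p, (p : ℝ≥0∞) ∂κ h := lintegral_add_compl _ (hA h)
  have hp' : ∫⁻ h, w₁ h + w₂ h ∂ν ≤ Pbar := by
    simp only [hsum]
    rwa [Measure.lintegral_compProd (f := fun z : ℝ × ℝ≥0 => (z.2 : ℝ≥0∞))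
      (by fun_prop)] at hp
  have hfin : ∀ᵐ h ∂ν, w₁ h + w₂ h ≠ ⊤ :=
    (ae_lt_top (hw₁m.add hw₂m) (hp'.trans_lt ENNReal.coe_lt_top).ne).mono fun h hh => hh.ne
  have hcompl (h : ℝ) : (κ h).real (A h)ᶜ = 1 - μ h := probReal_compl_eq_one_sub (hA h)
  -- The maximum only matters on the null set where the mean power is infinite and `toReal` is `0`.
  set v₁ : ℝ → ℝ := fun h => max (w₁ h).toReal (μ h * (t / h))
  set v₂ : ℝ → ℝ := fun h => (w₂ h).toReal with hv₂_def
  have hv₁ {h : ℝ} (hh : h ∈ H) (hf : w₁ h ≠ ⊤) : v₁ h = (w₁ h).toReal := by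
    have h0 : 0 < h := hHpos hh
    refine max_eq_left ?_
    have : ENNReal.ofReal (t / h) * κ h (A h) ≤ w₁ h := by
      rw [← setLIntegral_const]
      refine setLIntegral_mono (by fun_prop) fun p (hp : t ≤ h * p) => ?_
      rw [← ENNReal.ofReal_coe_nnreal]
      exact ENNReal.ofReal_le_ofReal ((div_le_iff₀' h0).2 hp)
    have := ENNReal.toReal_mono hf this
    rwa [ENNReal.toReal_mul, ENNReal.toReal_ofReal (by positivity), mul_comm] at this
  have hfeas : AISRPFeasible r R₀ H ν Pbar ε x μ v₁ v₂ :=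
    { measurable_μ := hμm
      measurable_v₁ := by fun_prop
      measurable_v₂ := by fun_prop
      μ_nonneg := fun h _ => measureReal_nonneg
      μ_le_one := fun h _ => measureReal_le_one
      v₁_nonneg := fun h _ => le_max_of_le_left ENNReal.toReal_nonneg
      v₂_nonneg := fun h _ => ENNReal.toReal_nonneg
      age := by
        rw [ENNReal.ofReal_le_iff_le_toReal (measure_ne_top _ _), Measure.compProd_apply hS] at hs
        exact hs.trans_eq (integral_toReal hκm.aemeasurable
          (ae_of_all _ fun h => measure_lt_top _ _)).symm
      power := by
        refine le_trans (lintegral_mono_ae ?_) hp'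
        filter_upwards [hH, hfin] with h hh hf
        rw [ENNReal.add_ne_top] at hf
        rw [hv₁ hh hf.1, hv₂_def, ENNReal.ofReal_add ENNReal.toReal_nonneg ENNReal.toReal_nonneg,
          ENNReal.ofReal_toReal hf.1, ENNReal.ofReal_toReal hf.2]
      le_v₁ := fun h _ => le_max_right _ _
      v₂_le := fun h hh => by
        have h0 : 0 < h := hHpos hh
        have : w₂ h ≤ ENNReal.ofReal (t / h) * κ h (A h)ᶜ := by
          rw [← setLIntegral_const]
          refine setLIntegral_mono measurable_const fun p (hp : ¬ t ≤ h * p) => ?_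
          rw [← ENNReal.ofReal_coe_nnreal]
          exact ENNReal.ofReal_le_ofReal ((le_div_iff₀' h0).2 (not_le.1 hp).le)
        have := ENNReal.toReal_mono
          (ENNReal.mul_ne_top ENNReal.ofReal_ne_top (measure_ne_top _ _)) this
        rwa [ENNReal.toReal_mul, ENNReal.toReal_ofReal (by positivity), mul_comm,
          ← measureReal_def, hcompl] at this }
  refine le_trans ?_ (le_sSup ⟨μ, v₁, v₂, hfeas, rfl⟩)
  rw [Measure.lintegral_compProd (f := fun z : ℝ × ℝ≥0 => reward r (z.1 * z.2)) (by fun_prop),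
    aisrpThroughput]
  refine lintegral_mono_ae ?_
  filter_upwards [hH, hfin] with h hh hf
  rw [ENNReal.add_ne_top] at hf
  have h0 : 0 < h := hHpos hh
  have hμ0 : 0 ≤ μ h := measureReal_nonneg
  have hμ1 : 0 ≤ 1 - μ h := sub_nonneg.2 measureReal_le_one
  have hJ₁ := hr.setLIntegral_reward_le (κ h) (A h) h0 hf.1
  have hJ₂ := hr.setLIntegral_reward_le (κ h) (A h)ᶜ h0 hf.2
  rw [hcompl] at hJ₂
  rw [hv₁ hh hf.1, ENNReal.ofReal_add
    (mul_nonneg hμ0 (hr.nonneg (div_nonneg (mul_nonneg h0.le ENNReal.toReal_nonneg) hμ0)))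
    (mul_nonneg hμ1 (hr.nonneg (div_nonneg (mul_nonneg h0.le ENNReal.toReal_nonneg) hμ1))),
    ← lintegral_add_compl _ (hA h)]
  exact add_le_add hJ₁ hJ₂

end Jensen

/-! ### Repairing constraints that are slightly violated -/

section Repair

variable {ν : Measure ℝ}

theorem fst_convexComb {Q₁ Q₂ : Measure (ℝ × ℝ≥0)} (h₁ : Q₁.fst = ν) (h₂ : Q₂.fst = ν)
    {β : ℝ≥0∞} (hβ : β ≤ 1) : (β • Q₁ + (1 - β) • Q₂).fst = ν := by
  ext s hs
  rw [Measure.fst_apply hs, Measure.add_apply, Measure.smul_apply, Measure.smul_apply,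
    ← Measure.fst_apply hs, ← Measure.fst_apply hs, h₁, h₂, smul_eq_mul, smul_eq_mul, ← add_mul,
    add_tsub_cancel_of_le hβ, one_mul]

/-- If the success probability falls short of `q` by at most `δ`, it can be repaired at a cost in
power proportional to `δ`, without loss of throughput: with a suitable probability, a power that is
too small for success is raised to the least power that suffices. -/
theorem exists_law_success_ge [IsProbabilityMeasure ν] {Q : Measure (ℝ × ℝ≥0)} (hQ : Q.fst = ν)
    {a t q δ : ℝ} (ha : 0 < a) (hae : ∀ᵐ h ∂ν, a ≤ h) (ht : 0 ≤ t) (hq : q ≤ 1)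
    (hs : q - δ ≤ Q.real {z | t ≤ z.1 * z.2}) :
    ∃ Q' : Measure (ℝ × ℝ≥0), Q'.fst = ν ∧ ENNReal.ofReal q ≤ Q' {z | t ≤ z.1 * z.2} ∧
      ∫⁻ z, (z.2 : ℝ≥0∞) ∂Q' ≤ ∫⁻ z, (z.2 : ℝ≥0∞) ∂Q + ENNReal.ofReal (δ * (t / a)) ∧
      ∀ g : ℝ → ℝ≥0∞, Monotone g → ∫⁻ z, g (z.1 * z.2) ∂Q ≤ ∫⁻ z, g (z.1 * z.2) ∂Q' := by
  have := isProbabilityMeasure_of_fst hQ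
  have haQ : ∀ᵐ z ∂Q, a ≤ z.1 := ae_fst_of_fst_eq hQ hae
  set S : Set (ℝ × ℝ≥0) := {z | t ≤ z.1 * z.2}
  have hS : MeasurableSet S := measurableSet_success t
  set s := Q.real S
  rcases le_or_gt q s with hqs | hqs
  · exact ⟨Q, hQ, ENNReal.ofReal_le_of_le_toReal hqs, le_self_add, fun g _ => le_rfl⟩
  have hs1 : 0 < 1 - s := by linarith
  have hQS : Q S = ENNReal.ofReal s := (ofReal_measureReal).symm
  have hQSc : Q Sᶜ = ENNReal.ofReal (1 - s) := by
    rw [← probReal_compl_eq_one_sub hS, ofReal_measureReal]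
  -- Raising the failing powers with probability `θ` gives success probability exactly `q`.
  set θ : ℝ := (q - s) / (1 - s)
  have hθ0 : 0 ≤ θ := div_nonneg (by linarith) hs1.le
  have hθ1 : θ ≤ 1 := (div_le_one hs1).2 (by linarith)
  have hθs : θ * (1 - s) = q - s := div_mul_cancel₀ _ hs1.ne'
  have hΘ1 : ENNReal.ofReal θ ≤ 1 := ENNReal.ofReal_le_one.2 hθ1
  have hΘc : 1 - ENNReal.ofReal θ = ENNReal.ofReal (1 - θ) := by
    rw [ENNReal.ofReal_sub _ hθ0, ENNReal.ofReal_one]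
  set T : ℝ × ℝ≥0 → ℝ × ℝ≥0 := fun z => (z.1, max z.2 (t / z.1).toNNReal) with hT_def
  have hT : Measurable T := by fun_prop
  have hTfst : (Q.map T).fst = ν := by
    rw [Measure.fst, Measure.map_map measurable_fst hT]
    exact hQ
  have hTS : Q.map T S = 1 := by
    rw [Measure.map_apply hT hS, ← mem_ae_iff_prob_eq_one (hT hS)]
    filter_upwards [haQ] with z hz
    have hz0 : 0 < z.1 := ha.trans_le hz
    change t ≤ z.1 * (max z.2 (t / z.1).toNNReal : ℝ≥0)
    rw [← div_le_iff₀' hz0, NNReal.coe_max]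
    exact le_max_of_le_right (Real.le_coe_toNNReal _)
  refine ⟨ENNReal.ofReal θ • Q.map T + (1 - ENNReal.ofReal θ) • Q,
    fst_convexComb hTfst hQ hΘ1, ?_, ?_, fun g hg => ?_⟩
  · rw [Measure.add_apply, Measure.smul_apply, Measure.smul_apply, hTS, hQS, hΘc, smul_eq_mul,
      smul_eq_mul, mul_one, ← ENNReal.ofReal_mul (sub_nonneg.2 hθ1), ← ENNReal.ofReal_add hθ0
      (mul_nonneg (sub_nonneg.2 hθ1) measureReal_nonneg)]
    exact ENNReal.ofReal_le_ofReal (by linarith)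
  · have hT_le : ∫⁻ z, (z.2 : ℝ≥0∞) ∂Q.map T ≤
        ∫⁻ z, (z.2 : ℝ≥0∞) ∂Q + ENNReal.ofReal (t / a) * Q Sᶜ := by
      rw [lintegral_map (by fun_prop) hT, ← lintegral_indicator_const hS.compl,
        ← lintegral_add_left (by fun_prop)]
      refine lintegral_mono_ae ?_
      filter_upwards [haQ] with z hz
      have hz0 : 0 < z.1 := ha.trans_le hz
      by_cases hzS : z ∈ S
      · have : (t / z.1).toNNReal ≤ z.2 := Real.toNNReal_le_iff_le_coe.2 ((div_le_iff₀' hz0).2 hzS)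
        simp [hT_def, max_eq_left this]
      · have : ((t / z.1).toNNReal : ℝ≥0∞) ≤ ENNReal.ofReal (t / a) :=
          ENNReal.ofReal_le_ofReal (by gcongr)
        rw [indicator_of_mem (show z ∈ Sᶜ from hzS)]
        simp only [hT_def, ENNReal.coe_max]
        exact max_le le_self_add (this.trans le_add_self)
    rw [lintegral_add_measure, lintegral_smul_measure, lintegral_smul_measure, smul_eq_mul,
      smul_eq_mul]
    calc _ ≤ ENNReal.ofReal θ * (∫⁻ z, (z.2 : ℝ≥0∞) ∂Q + ENNReal.ofReal (t / a) * Q Sᶜ) +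
            (1 - ENNReal.ofReal θ) * ∫⁻ z, (z.2 : ℝ≥0∞) ∂Q := by gcongr
      _ = (ENNReal.ofReal θ + (1 - ENNReal.ofReal θ)) * ∫⁻ z, (z.2 : ℝ≥0∞) ∂Q +
            ENNReal.ofReal θ * (ENNReal.ofReal (t / a) * Q Sᶜ) := by ring
      _ = ∫⁻ z, (z.2 : ℝ≥0∞) ∂Q + ENNReal.ofReal (θ * ((t / a) * (1 - s))) := by
        rw [add_tsub_cancel_of_le hΘ1, one_mul, hQSc, ← ENNReal.ofReal_mul (by positivity),
          ← ENNReal.ofReal_mul hθ0]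
      _ ≤ _ := by
        refine add_le_add_right (ENNReal.ofReal_le_ofReal ?_) _
        calc θ * ((t / a) * (1 - s)) = (θ * (1 - s)) * (t / a) := by ring
          _ ≤ δ * (t / a) := by
            rw [hθs]
            have : 0 ≤ t / a := by positivity
            gcongr
            linarith
  · have hgm := hg.measurable
    have hT_ge : ∫⁻ z, g (z.1 * z.2) ∂Q ≤ ∫⁻ z, g (z.1 * z.2) ∂Q.map T := by
      rw [lintegral_map (f := fun z : ℝ × ℝ≥0 => g (z.1 * z.2)) (by fun_prop) hT]
      refine lintegral_mono_ae ?_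
      filter_upwards [haQ] with z hz
      have hz0 : 0 < z.1 := ha.trans_le hz
      refine hg (mul_le_mul_of_nonneg_left ?_ hz0.le)
      exact NNReal.coe_le_coe.2 (le_max_left _ _)
    rw [lintegral_add_measure, lintegral_smul_measure, lintegral_smul_measure, smul_eq_mul,
      smul_eq_mul]
    calc _ = (ENNReal.ofReal θ + (1 - ENNReal.ofReal θ)) * ∫⁻ z, g (z.1 * z.2) ∂Q := by
          rw [add_tsub_cancel_of_le hΘ1, one_mul]
      _ ≤ _ := by
        rw [add_mul]
        gcongr

/-- A feasible point of the age-independent problem with some slack gives, for every sufficiently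
small slack, a law that meets the success requirement and leaves an amount `γ` of power unused: the
power needed for success with a smaller slack is smaller by an amount bounded away from zero. -/
theorem exists_law_with_spare_power [IsProbabilityMeasure ν] {r : ℝ → ℝ} (hr : IsRateFunction r)
    {R₀ ε₀ x b : ℝ} (hR₀ : 0 ≤ R₀) (hε₀ : 0 < ε₀) (hrange : R₀ + ε₀ ∈ r '' Ici 0) (hx : 0 < x)
    {H : Set ℝ} (hHpos : H ⊆ Ioi 0) (hH : ∀ᵐ h ∂ν, h ∈ H) (hb : 0 < b) (hHb : ∀ h ∈ H, h ≤ b)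
    {Pbar : ℝ≥0} {μ v₁ v₂ : ℝ → ℝ} (hf : AISRPFeasible r R₀ H ν Pbar ε₀ x μ v₁ v₂) :
    ∃ γ : ℝ≥0∞, γ ≠ 0 ∧ ∀ ε, 0 < ε → ε ≤ ε₀ / 2 → ∃ Q : Measure (ℝ × ℝ≥0), Q.fst = ν ∧
      ENNReal.ofReal (1 / x) ≤ Q {z | rateInv r (R₀ + ε) ≤ z.1 * z.2} ∧
      ∫⁻ z, (z.2 : ℝ≥0∞) ∂Q + γ ≤ Pbar := by
  have hrg {ε : ℝ} (h0 : 0 < ε) (h1 : ε ≤ ε₀) : R₀ + ε ∈ r '' Ici 0 :=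
    hr.mem_range_of_le (by linarith) (by linarith) hrange
  set t₀ := rateInv r (R₀ + ε₀)
  set t₁ := rateInv r (R₀ + ε₀ / 2)
  have ht : t₁ < t₀ := hr.rateInv_lt (hrg (by linarith) (by linarith)) hrange (by linarith)
  have hμ := hf.measurable_μ
  have hage := hf.ofReal_age_le hH
  have hd : 0 < (t₀ - t₁) / b := div_pos (sub_pos.2 ht) hb
  refine ⟨ENNReal.ofReal ((t₀ - t₁) / b) * ENNReal.ofReal (1 / x), ?_, fun ε h0 h1 => ?_⟩
  · exact mul_ne_zero (ENNReal.ofReal_pos.2 hd).ne' (ENNReal.ofReal_pos.2 (by positivity)).ne'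
  have hεr := hrg h0 (by linarith)
  have htn := rateInv_nonneg hεr
  have htt : rateInv r (R₀ + ε) ≤ t₁ := by
    rw [hr.rateInv_le_iff hεr (rateInv_nonneg (hrg (by linarith) (by linarith))),
      apply_rateInv (hrg (by linarith) (by linarith))]
    linarith
  set t := rateInv r (R₀ + ε)
  set m : ℝ → ℝ≥0∞ := fun h => ENNReal.ofReal (μ h) with hm_def
  set p : ℝ → ℝ≥0 := fun h => (t / h).toNNReal
  have hm : Measurable m := by fun_prop
  have hp : Measurable p := by fun_prop
  have hS := measurableSet_success t
  refine ⟨twoPointLaw ν m p 0, twoPointLaw_fst hm hp measurable_zero ?_, ?_, ?_⟩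
  · filter_upwards [hH] with h hh using ENNReal.ofReal_le_one.2 (hf.μ_le_one h hh)
  · rw [twoPointLaw_apply hm hp measurable_zero hS]
    refine hage.trans (lintegral_mono_ae ?_)
    filter_upwards [hH] with h hh
    refine le_trans ?_ le_self_add
    have h0 : 0 < h := hHpos hh
    have hmem : (h, p h) ∈ {z : ℝ × ℝ≥0 | t ≤ z.1 * z.2} := by
      change t ≤ h * ((t / h).toNNReal : ℝ)
      rw [← div_le_iff₀' h0]
      exact Real.le_coe_toNNReal _
    rw [indicator_of_mem hmem]
    simp [hm_def]
  · rw [lintegral_twoPointLaw (f := fun z => (z.2 : ℝ≥0∞)) hm hp measurable_zero (by fun_prop)]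
    refine le_trans ?_ hf.power
    calc _ ≤ ∫⁻ h, m h * p h ∂ν + ENNReal.ofReal ((t₀ - t₁) / b) * ∫⁻ h, m h ∂ν := by
          gcongr
          simp
      _ = ∫⁻ h, m h * p h + ENNReal.ofReal ((t₀ - t₁) / b) * m h ∂ν := by
          rw [← lintegral_const_mul _ hm, lintegral_add_left (by fun_prop)]
      _ ≤ _ := by
        refine lintegral_mono_ae ?_
        filter_upwards [hH] with h hh
        have h0 : 0 < h := hHpos hh
        have hμ0 := hf.μ_nonneg h hh
        change ENNReal.ofReal _ * ENNReal.ofReal _ + ENNReal.ofReal _ * ENNReal.ofReal _ ≤ _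
        rw [← ENNReal.ofReal_mul hμ0, ← ENNReal.ofReal_mul hd.le,
          ← ENNReal.ofReal_add (by positivity) (by positivity)]
        refine ENNReal.ofReal_le_ofReal ?_
        have h1 : (t₀ - t₁) / b ≤ (t₀ - t₁) / h := by
          have := hHb h hh
          have := sub_pos.2 ht
          gcongr
        have h2 : t / h + (t₀ - t₁) / h ≤ t₀ / h := by
          rw [← add_div]
          gcongr
          linarith
        calc μ h * (t / h) + (t₀ - t₁) / b * μ h = μ h * (t / h + (t₀ - t₁) / b) := by ring
          _ ≤ μ h * (t₀ / h) := by gcongr; linarith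
          _ ≤ v₁ h := hf.le_v₁ h hh
          _ ≤ v₁ h + v₂ h := le_add_of_nonneg_right (hf.v₂_nonneg h hh)

end Repair

/-! ### The upper bound and its attainment -/

section UpperBound

variable {r : ℝ → ℝ} {R₀ : ℝ} {H : Set ℝ} {ν : Measure ℝ} {Pbar : ℝ≥0}

/-- The event `r (h P) > R₀` is the increasing union of the events `r (h P) ≥ R₀ + ε` as `ε ↓ 0`, so
a strict lower bound on its probability persists for all sufficiently small slacks. -/
theorem exists_slack_of_lt_success [IsProbabilityMeasure ν] (hr : IsRateFunction r)
    (hpos : ∀ᵐ h ∂ν, 0 < h) {Q : Measure (ℝ × ℝ≥0)} (hQ : Q.fst = ν) {l : ℝ≥0∞}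
    (hl : l < Q (successSet r R₀)) :
    ∃ ε₁, 0 < ε₁ ∧ ∀ ε, ε ≤ ε₁ → R₀ + ε ∈ r '' Ici 0 →
      l < Q {z | rateInv r (R₀ + ε) ≤ z.1 * z.2} := by
  have hU : successSet r R₀ =
      ⋃ n : ℕ, {z : ℝ × ℝ≥0 | R₀ + 1 / ((n : ℝ) + 1) ≤ r (max (z.1 * z.2) 0)} := by
    ext z
    simp only [successSet, mem_ofPred_eq, mem_iUnion]
    refine ⟨fun h => ?_, fun ⟨n, hn⟩ => (lt_add_of_pos_right _ Nat.one_div_pos_of_nat).trans_le hn⟩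
    obtain ⟨n, hn⟩ := exists_nat_one_div_lt (sub_pos.2 h)
    exact ⟨n, by linarith⟩
  have hmono : Monotone fun n : ℕ =>
      {z : ℝ × ℝ≥0 | R₀ + 1 / ((n : ℝ) + 1) ≤ r (max (z.1 * z.2) 0)} := fun n k hnk z hz =>
    (add_le_add_right (Nat.one_div_le_one_div hnk) R₀).trans hz
  rw [hU, hmono.measure_iUnion, lt_iSup_iff] at hl
  obtain ⟨n, hn⟩ := hl
  refine ⟨1 / ((n : ℝ) + 1), Nat.one_div_pos_of_nat, fun ε hε hrange => hn.trans_le ?_⟩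
  refine measure_mono_ae ?_
  filter_upwards [ae_fst_of_fst_eq hQ hpos] with z hz hzn
  have h0 : 0 ≤ z.1 * z.2 := by positivity
  change R₀ + _ ≤ r (max _ _) at hzn
  rw [max_eq_left h0] at hzn
  exact (hr.rateInv_le_iff hrange h0).2 (by linarith)

/-- Every policy is asymptotically dominated by the age-independent policies of small slack. The
average law over a long horizon violates the constraints slightly; the success rate is repaired by
raising some powers, and the power constraint by mixing in a law with spare power. -/
theorem liminf_avgThroughput_le (hr : IsRateFunction r) (hR₀ : 0 ≤ R₀) (hHc : IsCompact H)
    (hHpos : H ⊆ Ioi 0) [IsProbabilityMeasure ν] (hH : ∀ᵐ h ∂ν, h ∈ H) {x ε₀ : ℝ} (hx : 1 ≤ x)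
    (hε₀ : 0 < ε₀) (hrange : R₀ + ε₀ ∈ r '' Ici 0) {μ v₁ v₂ : ℝ → ℝ}
    (hf : AISRPFeasible r R₀ H ν Pbar ε₀ x μ v₁ v₂) (π : Policy)
    (hs : ENNReal.ofReal (1 / x) ≤ liminf (avgSuccess r R₀ ν π) atTop)
    (hp : limsup (avgPower ν π) atTop ≤ Pbar) :
    liminf (avgThroughput r ν π) atTop ≤
      liminf (fun ε => aisrpValue r R₀ H ν Pbar ε x) (𝓝[>] 0) := by
  have hpos : ∀ᵐ h ∂ν, 0 < h := hH.mono fun h hh => hHpos hh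
  have hx0 : 0 < x := by linarith
  have hHne : H.Nonempty := hH.exists
  obtain ⟨a, haH, haLe⟩ := hHc.exists_isLeast hHne
  obtain ⟨b, hbH, hbLe⟩ := hHc.exists_isGreatest hHne
  have ha : 0 < a := hHpos haH
  have hrg {ε : ℝ} (h0 : 0 < ε) (h1 : ε ≤ ε₀) : R₀ + ε ∈ r '' Ici 0 :=
    hr.mem_range_of_le (by linarith) (by linarith) hrange
  obtain ⟨γ, hγ, hspare⟩ := exists_law_with_spare_power hr hR₀ hε₀ hrange hx0 hHpos hH
    (hHpos hbH) hbLe hf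
  rw [← one_mul (liminf (avgThroughput r ν π) atTop)]
  -- It suffices to reach `β * c` for all `β < 1` and all `c` below the lower limit.
  refine ENNReal.mul_le_of_forall_lt fun β hβ c hc => le_liminf_of_le (by isBoundedDefault) ?_
  have hγ_top : γ ≠ ⊤ := by
    obtain ⟨_, _, _, h⟩ := hspare (ε₀ / 2) (by linarith) le_rfl
    exact ((le_add_self.trans h).trans_lt ENNReal.coe_lt_top).ne
  -- The power constraint may be exceeded by `e` before mixing in spare power with weight `1 - β`.
  set e : ℝ≥0∞ := (1 - β) * γ with he_def
  have he : e ≠ 0 := mul_ne_zero (tsub_pos_of_lt hβ).ne' hγ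
  have he_top : e ≠ ⊤ := ENNReal.mul_ne_top (by finiteness) hγ_top
  have he2 : e / 2 ≠ 0 := (ENNReal.half_pos he).ne'
  have he2_top : e / 2 ≠ ⊤ := ENNReal.div_ne_top he_top two_ne_zero
  set t₀ := rateInv r (R₀ + ε₀)
  have ht₀0 : 0 ≤ t₀ := rateInv_nonneg hrange
  have he2_pos : 0 < (e / 2).toReal := ENNReal.toReal_pos he2 he2_top
  -- Repairing a shortfall `δ` of the success rate costs at most `e / 2` of power.
  set δ : ℝ := (e / 2).toReal / ((t₀ + 1) / a)
  have hδ : 0 < δ := by positivity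
  have hδt : δ * ((t₀ + 1) / a) = (e / 2).toReal := div_mul_cancel₀ _ (by positivity)
  obtain ⟨K, hK0, hKc, hKs, hKp⟩ : ∃ K : ℕ, K ≠ 0 ∧ c < avgThroughput r ν π K ∧
      ENNReal.ofReal (1 / x - δ) < avgSuccess r R₀ ν π K ∧ avgPower ν π K < Pbar + e / 2 := by
    have hs' : ENNReal.ofReal (1 / x - δ) < liminf (avgSuccess r R₀ ν π) atTop :=
      ((ENNReal.ofReal_lt_ofReal_iff (by positivity)).2 (by linarith)).trans_le hs
    have hp' : limsup (avgPower ν π) atTop < Pbar + e / 2 :=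
      hp.trans_lt (ENNReal.lt_add_right ENNReal.coe_ne_top he2)
    exact ((eventually_ne_atTop 0).and ((eventually_lt_of_lt_liminf hc).and
      ((eventually_lt_of_lt_liminf hs').and (eventually_lt_of_limsup_lt hp')))).exists
  rw [avgThroughput_eq hr hpos] at hKc
  rw [avgSuccess_eq hr hpos] at hKs
  rw [avgPower_eq] at hKp
  have hQ := avgLaw_fst (ν := ν) π hK0
  obtain ⟨ε₁, hε₁, hsucc⟩ := exists_slack_of_lt_success hr hpos hQ hKs
  filter_upwards [Ioc_mem_nhdsGT (show 0 < min ε₁ (ε₀ / 2) by positivity)] with ε hε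
  have hε2 : ε ≤ ε₀ / 2 := hε.2.trans (min_le_right _ _)
  have hεr := hrg hε.1 (by linarith)
  have htle : rateInv r (R₀ + ε) ≤ t₀ := by
    rw [hr.rateInv_le_iff hεr ht₀0, apply_rateInv hrange]
    linarith
  have hQprob := isProbabilityMeasure_of_fst hQ
  have hQs : 1 / x - δ ≤ (avgLaw ν π K).real {z | rateInv r (R₀ + ε) ≤ z.1 * z.2} :=
    (ENNReal.ofReal_le_iff_le_toReal (measure_ne_top _ _)).1
      (hsucc ε (hε.2.trans (min_le_left _ _)) hεr).le
  obtain ⟨Q₁, hQ₁, hQ₁s, hQ₁p, hQ₁g⟩ := exists_law_success_ge hQ ha (hH.mono haLe)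
    (rateInv_nonneg hεr) ((div_le_one hx0).2 hx) hQs
  obtain ⟨Q₂, hQ₂, hQ₂s, hQ₂p⟩ := hspare ε hε.1 hε2
  have hQ₁p' : ∫⁻ z, (z.2 : ℝ≥0∞) ∂Q₁ ≤ Pbar + e := by
    have : ENNReal.ofReal (δ * (rateInv r (R₀ + ε) / a)) ≤ e / 2 := by
      rw [← ENNReal.ofReal_toReal he2_top, ← hδt]
      refine ENNReal.ofReal_le_ofReal ?_
      gcongr
      linarith
    calc _ ≤ (Pbar + e / 2) + e / 2 := hQ₁p.trans (add_le_add hKp.le this)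
      _ = Pbar + e := by rw [add_assoc, ENNReal.add_halves]
  have hβ1 : β + (1 - β) = 1 := add_tsub_cancel_of_le hβ.le
  refine le_trans ?_ (le_aisrpValue hr hHpos hH hεr (fst_convexComb hQ₁ hQ₂ hβ.le) ?_ ?_)
  · rw [lintegral_add_measure, lintegral_smul_measure, smul_eq_mul]
    refine le_trans ?_ le_self_add
    gcongr
    exact hKc.le.trans (hQ₁g _ hr.monotone_reward)
  · rw [Measure.add_apply, Measure.smul_apply, Measure.smul_apply, smul_eq_mul, smul_eq_mul]
    calc ENNReal.ofReal (1 / x) = (β + (1 - β)) * ENNReal.ofReal (1 / x) := by rw [hβ1, one_mul]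
      _ ≤ _ := by
        rw [add_mul]
        gcongr
  · rw [lintegral_add_measure, lintegral_smul_measure, lintegral_smul_measure, smul_eq_mul,
      smul_eq_mul]
    calc _ ≤ β * (Pbar + e) + (1 - β) * ∫⁻ z, (z.2 : ℝ≥0∞) ∂Q₂ := by gcongr
      _ ≤ β * Pbar + 1 * e + (1 - β) * ∫⁻ z, (z.2 : ℝ≥0∞) ∂Q₂ := by
        rw [mul_add]
        gcongr
      _ = β * Pbar + (1 - β) * (∫⁻ z, (z.2 : ℝ≥0∞) ∂Q₂ + γ) := by
        rw [he_def]
        ring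
      _ ≤ β * Pbar + (1 - β) * Pbar := by gcongr
      _ = Pbar := by rw [← add_mul, hβ1, one_mul]

/-- The linear growth of the rate bounds the throughput in terms of the power. -/
theorem avgThroughput_le_avgPower (hr : IsRateFunction r) [IsProbabilityMeasure ν]
    (hpos : ∀ᵐ h ∂ν, 0 < h) {b : ℝ} (hb : ∀ᵐ h ∂ν, h ≤ b) (π : Policy) {K : ℕ} (hK : K ≠ 0) :
    avgThroughput r ν π K ≤
      ENNReal.ofReal (r 1) * (1 + ENNReal.ofReal b * avgPower ν π K) := by
  have hQ := avgLaw_fst (ν := ν) π hK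
  have := isProbabilityMeasure_of_fst hQ
  rw [avgThroughput_eq hr hpos, avgPower_eq, ← lintegral_const_mul _ (by fun_prop)]
  have h1 : (1 : ℝ≥0∞) = ∫⁻ _, 1 ∂avgLaw ν π K := by simp
  conv_rhs => rw [h1]
  rw [← lintegral_add_left measurable_const, ← lintegral_const_mul _ (by fun_prop)]
  refine lintegral_mono_ae ?_
  filter_upwards [ae_fst_of_fst_eq hQ hpos, ae_fst_of_fst_eq hQ hb] with z hz hzb
  have h0 : 0 ≤ z.1 * z.2 := by positivity
  have hb0 : 0 ≤ b := hz.le.trans hzb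
  rw [reward_of_nonneg h0, ← ENNReal.ofReal_coe_nnreal, ← ENNReal.ofReal_mul hb0,
    ← ENNReal.ofReal_one, ← ENNReal.ofReal_add zero_le_one (by positivity),
    ← ENNReal.ofReal_mul (hr.nonneg zero_le_one)]
  refine ENNReal.ofReal_le_ofReal ((hr.le_mul h0).trans ?_)
  have := hr.nonneg zero_le_one
  gcongr

theorem upperBoundValue_lt_top (hr : IsRateFunction r) [IsProbabilityMeasure ν]
    (hpos : ∀ᵐ h ∂ν, 0 < h) {b : ℝ} (hb : ∀ᵐ h ∂ν, h ≤ b) (α : ℝ) :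
    upperBoundValue r R₀ ν α Pbar < ⊤ := by
  refine lt_of_le_of_lt (b := ENNReal.ofReal (r 1) * (1 + ENNReal.ofReal b * Pbar))
    (sSup_le ?_) (by finiteness)
  rintro ρ ⟨π, hρ, -, p, hp, hpP⟩
  have hlim : Tendsto (fun K => ENNReal.ofReal (r 1) * (1 + ENNReal.ofReal b * avgPower ν π K))
      atTop (𝓝 (ENNReal.ofReal (r 1) * (1 + ENNReal.ofReal b * p))) :=
    ENNReal.Tendsto.const_mul (tendsto_const_nhds.add
      (ENNReal.Tendsto.const_mul hp (Or.inr ENNReal.ofReal_ne_top))) (Or.inr ENNReal.ofReal_ne_top)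
  refine (le_of_tendsto_of_tendsto hρ hlim ?_).trans (by gcongr)
  filter_upwards [eventually_ne_atTop 0] with K hK
  exact avgThroughput_le_avgPower hr hpos hb π hK

theorem upperBoundValue_le_upperBoundValueLiminf (r : ℝ → ℝ) (R₀ : ℝ) (ν : Measure ℝ) (α : ℝ)
    (Pbar : ℝ≥0) : upperBoundValue r R₀ ν α Pbar ≤ upperBoundValueLiminf r R₀ ν α Pbar := by
  refine sSup_le_sSup ?_
  rintro ρ ⟨π, hρ, ⟨s, hs, hqs⟩, p, hp, hpP⟩
  exact ⟨π, hρ.liminf_eq.symm, hs.liminf_eq.symm ▸ hqs, hp.limsup_eq.symm ▸ hpP⟩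

end UpperBound

end FadingAoI

theorem theorem2
    (r : ℝ → ℝ) (hr : FadingAoI.IsRateFunction r)
    (R₀ : ℝ) (hR₀ : 0 ≤ R₀)
    (H : Set ℝ) (hHc : IsCompact H) (hHpos : H ⊆ Set.Ioi 0)
    (ν : MeasureTheory.Measure ℝ) [MeasureTheory.IsProbabilityMeasure ν] (hν : ν Hᶜ = 0)
    (α : ℝ) (hα : 1 ≤ α) (Pbar : ℝ≥0)
    (hfeas : ∃ ε : ℝ, 0 < ε ∧ R₀ + ε ∈ r '' Set.Ici 0 ∧
      ∃ μ v₁ v₂ : ℝ → ℝ, FadingAoI.AISRPFeasible r R₀ H ν Pbar ε (2 * α - 1) μ v₁ v₂) :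
    FadingAoI.upperBoundValue r R₀ ν α Pbar < ⊤ ∧
    Filter.Tendsto (fun ε : ℝ => FadingAoI.aisrpValue r R₀ H ν Pbar ε (2 * α - 1))
      (nhdsWithin 0 (Set.Ioi 0)) (nhds (FadingAoI.upperBoundValue r R₀ ν α Pbar)) ∧
    FadingAoI.upperBoundValueLiminf r R₀ ν α Pbar = FadingAoI.upperBoundValue r R₀ ν α Pbar := by
  have hH : ∀ᵐ h ∂ν, h ∈ H := mem_ae_iff.2 hν
  have hpos : ∀ᵐ h ∂ν, 0 < h := hH.mono fun h hh => hHpos hh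
  obtain ⟨b, hb⟩ := hHc.bddAbove
  obtain ⟨ε₀, hε₀, hrange, μ, v₁, v₂, hf⟩ := hfeas
  have hlower := FadingAoI.upperBoundValue_le_upperBoundValueLiminf r R₀ ν α Pbar
  have hupper : FadingAoI.upperBoundValueLiminf r R₀ ν α Pbar ≤
      liminf (fun ε => FadingAoI.aisrpValue r R₀ H ν Pbar ε (2 * α - 1)) (𝓝[>] 0) := by
    refine sSup_le ?_
    rintro ρ ⟨π, rfl, hs, hp⟩
    exact FadingAoI.liminf_avgThroughput_le hr hR₀ hHc hHpos hH (by linarith) hε₀ hrange hf π hs hp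
  have hlimsup : limsup (fun ε => FadingAoI.aisrpValue r R₀ H ν Pbar ε (2 * α - 1)) (𝓝[>] 0) ≤
      FadingAoI.upperBoundValue r R₀ ν α Pbar := by
    refine limsup_le_of_le (by isBoundedDefault) ?_
    filter_upwards [Ioc_mem_nhdsGT hε₀] with ε hε
    refine sSup_le ?_
    rintro ρ ⟨μ', v₁', v₂', hf', rfl⟩
    exact hf'.throughput_le_upperBoundValue hr hHpos hH hε.1
      (hr.mem_range_of_le (by linarith [hε.1]) (by linarith [hε.2]) hrange)
  refine ⟨FadingAoI.upperBoundValue_lt_top hr hpos (hH.mono hb) α,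
    tendsto_of_le_liminf_of_limsup_le (hlower.trans hupper) hlimsup,
    le_antisymm (hupper.trans ((liminf_le_limsup).trans hlimsup)) hlower⟩
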